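/- For integers $1\le r\le n$ let $X_r$ be the graph whose vertices are the binary sequences of length $n$, two of them being adjacent iff their Hamming distance is $r$ (a distance graph of the binary Hamming scheme $\mathcal H(n,2)$). For a finite graph $X$ with adjacency matrix $A$ put $U(t)=e^{-\mathrm{i}tA}$, and let $\mathbf e_a$ be the unit vector of the vertex $a$. The graph $X$ has balanced fractional revival at time $\tau>0$ if there are $\alpha,\beta\in\mathbb C$ with $|\alpha|=|\beta|=1/\sqrt2$ such that for every vertex $a$ there is a vertex $b\neq a$ with $U(\tau)\mathbf e_a=\alpha\,\mathbf e_a+\beta\,\mathbf e_b$. For a positive integer $m$ let $\alpha_2(m)$ be the largest $k$ such that $2^k$ divides $m$. Binary digits are numbered from the least significant one, which is the $0$-th digit. **Proposition.** Let $1\le r\le n$. The following are equivalent. (A) $X_r$ is connected and has balanced fractional revival at time $\pi/8$. (B) (i) $n$ is odd, and $n-1\neq 2^a(2^b-1)$ for all non-negative integers $a,b$; and (ii) the binary expansion of $r-1$ is obtained from that of $n-1$ (with leading zeros allowed) by keeping the digits in positions $0,1,\dots,\alpha_2(n-1)$, replacing exactly one substring "$10$" (in two adjacent positions) by "$01$",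 and replacing some (possibly none) of the digits "$1$" of $n-1$ in other positions by "$0$", all remaining digits being unchanged. (C) $n$ is odd, $\alpha_2(n-1)=\alpha_2(r-1)$, and $\binom{n-1}{r-1}\equiv 2\pmod 4$. (The last condition forces $n,r\ge2$, so that both valuations are defined.) -/

import Mathlib

open scoped Matrix

noncomputable section

/-- The distance graph `X_r` of the binary Hamming scheme `H(n,2)`: its vertices are the binary
sequences of length `n`, and two (distinct) sequences are adjacent iff their Hamming distance
is `r`. For `1 ≤ r` the distinctness is automatic. -/
def hammingGraph (n r : ℕ) : SimpleGraph (Fin n → Bool) where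
  Adj x y := x ≠ y ∧ hammingDist x y = r
  symm := ⟨fun x y h => ⟨h.1.symm, by rw [hammingDist_comm]; exact h.2⟩⟩
  loopless := ⟨fun _ h => h.1 rfl⟩

section QuantumWalk

variable {V : Type*} [Fintype V] [DecidableEq V]

open Classical in
/-- The transition matrix `U(t) = exp(-i t A(X))` of the continuous-time quantum walk on `X`. -/
def transitionMatrix (X : SimpleGraph V) (t : ℝ) : Matrix V V ℂ :=
  NormedSpace.exp ((-(Complex.I * (t : ℂ))) • X.adjMatrix ℂ)

/-- `(α, β)`-revival occurs from `a` to `b` at time `τ`: the vertices `a`, `b` are distinct,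
`τ > 0`, `β ≠ 0`, `|α|² + |β|² = 1` and `U(τ) e_a = α e_a + β e_b`. -/
def RevivalFromTo (X : SimpleGraph V) (α β : ℂ) (τ : ℝ) (a b : V) : Prop :=
  a ≠ b ∧ 0 < τ ∧ β ≠ 0 ∧ ‖α‖ ^ 2 + ‖β‖ ^ 2 = 1 ∧
    transitionMatrix X τ *ᵥ (Pi.single a 1 : V → ℂ) =
      α • (Pi.single a 1 : V → ℂ) + β • (Pi.single b 1 : V → ℂ)

/-- `X` has `(α, β)`-revival at time `τ`: it occurs from every vertex. -/
def HasRevival (X : SimpleGraph V) (α β : ℂ) (τ : ℝ) : Prop :=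
  ∀ a : V, ∃ b : V, RevivalFromTo X α β τ a b

/-- `X` has balanced fractional revival at time `τ`: it has `(α, β)`-revival at time `τ` for some
`α`, `β` with `|α| = |β| = 1/√2`. -/
def HasBalancedRevival (X : SimpleGraph V) (τ : ℝ) : Prop :=
  ∃ α β : ℂ, ‖α‖ = 1 / √2 ∧ ‖β‖ = 1 / √2 ∧ HasRevival X α β τ

end QuantumWalk

/-- `BinaryRewrite m k`: the binary expansion of `k` is obtained from that of `m` by
* keeping the digits in positions `0, …, α₂(m)`, where `α₂(m) = padicValNat 2 m`;
* replacing exactly one substring `10`, in the positions `p + 1` and `p`, by `01`;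
* replacing the digits `1` in a (possibly empty) set `Z` of other positions by `0`.

All other digits are unchanged. Digits are numbered from the least significant one, which has
position `0`. -/
def BinaryRewrite (m k : ℕ) : Prop :=
  ∃ (p : ℕ) (Z : Finset ℕ),
    (m.testBit (p + 1) = true ∧ m.testBit p = false) ∧
    (k.testBit (p + 1) = false ∧ k.testBit p = true) ∧
    (∀ j ∈ Z, j ≠ p ∧ j ≠ p + 1 ∧ m.testBit j = true ∧ k.testBit j = false) ∧
    (∀ j, j ∉ Z → j ≠ p → j ≠ p + 1 → k.testBit j = m.testBit j) ∧
    (∀ j ≤ padicValNat 2 m, k.testBit j = m.testBit j)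

end

/-! The characters of (ℤ/2)^n diagonalise the adjacency matrix; at weight j the eigenvalue is the
Krawtchouk number K(j) = `krawtchouk n r j`. Characters of weight 1 force the revival partner of 0
to be the all-ones vector, so balanced revival at π/8 means exp(-iπK(j)/8) = α + β(-1)^j
(`hasBalancedRevival_hammingGraph_iff`), that is, K(0) - K(1) ≡ 4 mod 8 and K(j) ≡ K(j+2) mod 16
(`exists_balanced_iff`).

Put N = n-1, k = r-1. Since K(j) - K(j+1) and K(j) - K(j+2) are 2 and 4 times smaller Krawtchouk
numbers, the first congruence says C(N,k) ≡ 2 mod 4, and the second at j = 0 says 4 ∣ C(N-1,k). For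
even k these give N even and equal valuations (`Nat.choose_pred_mod_four_iff`); conversely,
divisibility at j = 0 propagates to all j (`four_dvd_krawtchouk`). Connectedness contributes that r
is odd. Conditions (B) and (C) agree by a digit criterion for C(N,k) ≡ 2 mod 4
(`Nat.choose_mod_four_eq_two_iff_testBit`). -/

/-! ### Binomial coefficients modulo 2 and 4. -/

/-- Modulo 4, ((1+X²) + 2X)^N ≡ (1+X²)^N + 2NX(1+X²)^(N-1), and N·C(N-1,k) = (k+1)·C(N,k+1). The
induction multiplies by (1+X)². -/
theorem Nat.two_mul_choose_mod_four (N : ℕ) : ∀ k : ℕ,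
    (2 * N).choose (2 * k) ≡ N.choose k [MOD 4] ∧
      (2 * N).choose (2 * k + 1) ≡ 2 * ((k + 1) * N.choose (k + 1)) [MOD 4] := by
  induction N with
  | zero => intro k; cases k <;> simp [Nat.ModEq, Nat.mul_add]
  | succ N ih =>
    have key : ∀ j, (2 * (N + 1)).choose (j + 2) =
        (2 * N).choose j + 2 * (2 * N).choose (j + 1) + (2 * N).choose (j + 2) := by
      intro j
      rw [show 2 * (N + 1) = 2 * N + 1 + 1 by ring, Nat.choose_succ_succ', Nat.choose_succ_succ',
        Nat.choose_succ_succ']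
      ring
    intro k
    constructor
    · cases k with
      | zero => simp [Nat.ModEq]
      | succ k =>
        rw [show 2 * (k + 1) = 2 * k + 2 by ring, key, Nat.choose_succ_succ']
        have h1 := (ih k).1
        have h2 := (ih k).2
        have h3 := (ih (k + 1)).1
        rw [show 2 * (k + 1) = 2 * k + 2 by ring] at h3
        unfold Nat.ModEq at *
        omega
    · cases k with
      | zero => simp [Nat.ModEq]
      | succ k =>
        rw [show 2 * (k + 1) + 1 = (2 * k + 1) + 2 by ring, key, Nat.choose_succ_succ']
        have h1 := (ih k).2
        have h2 := (ih (k + 1)).1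
        have h3 := (ih (k + 1)).2
        rw [show 2 * (k + 1) = 2 * k + 1 + 1 by ring] at h2 h3
        rw [show 2 * k + 1 + 1 + 1 = 2 * k + 1 + 2 by ring] at h3
        have e : (k + 1 + 1) * (N.choose (k + 1) + N.choose (k + 1 + 1)) =
          (k + 1) * N.choose (k + 1) + N.choose (k + 1) +
            (k + 1 + 1) * N.choose (k + 1 + 1) := by ring
        rw [e]
        unfold Nat.ModEq at *
        omega

/-- Pascal's rule gives (1 + 2(N-k))·C(N,k) modulo 4, and an odd factor preserves the class 2. -/
theorem Nat.two_mul_add_one_choose_two_mul_add_one_mod_four (N k : ℕ) :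
    (2 * N + 1).choose (2 * k + 1) % 4 = 2 ↔ N.choose k % 4 = 2 := by
  rw [Nat.choose_succ_succ']
  obtain ⟨h1, h2⟩ := Nat.two_mul_choose_mod_four N k
  have h3 : (k + 1) * N.choose (k + 1) = (N - k) * N.choose k := by
    rw [mul_comm, Nat.choose_succ_right_eq, mul_comm]
  have h4 := Nat.mod_mod_of_dvd ((N - k) * N.choose k) (show 2 ∣ 4 by norm_num)
  rw [h3] at h2
  have h5 : ((N - k) * N.choose k) % 2 = ((N - k) % 2 * (N.choose k % 2)) % 2 := Nat.mul_mod _ _ _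
  unfold Nat.ModEq at *
  rcases Nat.mod_two_eq_zero_or_one (N - k) with h | h <;>
  rcases Nat.mod_two_eq_zero_or_one (N.choose k) with h' | h' <;> simp [h, h'] at h5 <;> omega

theorem Nat.two_mul_add_one_choose_two_mul_mod_four (N k : ℕ) :
    (2 * N + 1).choose (2 * k) % 4 = 2 ↔ N.choose k % 4 = 2 := by
  cases k with
  | zero => simp
  | succ k =>
    rw [show 2 * (k + 1) = 2 * k + 1 + 1 by ring, Nat.choose_succ_succ']
    have h1 := (Nat.two_mul_choose_mod_four N (k + 1)).1
    have h2 := (Nat.two_mul_choose_mod_four N k).2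
    rw [show 2 * (k + 1) = 2 * k + 1 + 1 by ring] at h1
    have h5 : ((k + 1) * N.choose (k + 1)) % 2 = ((k + 1) % 2 * (N.choose (k + 1) % 2)) % 2 :=
      Nat.mul_mod _ _ _
    unfold Nat.ModEq at *
    rcases Nat.mod_two_eq_zero_or_one (k + 1) with h | h <;>
    rcases Nat.mod_two_eq_zero_or_one (N.choose (k + 1)) with h' | h' <;>
      simp [h, h'] at h5 <;> omega

theorem forall_nat_iff_zero_and_succ {P : ℕ → Prop} : (∀ j, P j) ↔ P 0 ∧ ∀ j, P (j + 1) :=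
  ⟨fun h => ⟨h 0, fun j => h _⟩, fun h j => by cases j; exacts [h.1, h.2 _]⟩

theorem exists_nat_iff_zero_or_succ {P : ℕ → Prop} : (∃ j, P j) ↔ P 0 ∨ ∃ j, P (j + 1) := by
  constructor
  · rintro ⟨_ | j, h⟩
    exacts [Or.inl h, Or.inr ⟨j, h⟩]
  · rintro (h | ⟨j, h⟩)
    exacts [⟨_, h⟩, ⟨_, h⟩]

theorem Nat.two_mul_add_one_div_two (N : ℕ) : (2 * N + 1) / 2 = N := by omega

/-- Lucas's theorem at the prime 2, by stripping the last digits of N and k. -/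
theorem Nat.choose_mod_two_eq_one_iff_testBit (N : ℕ) : ∀ k : ℕ,
    N.choose k % 2 = 1 ↔ ∀ j, k.testBit j = true → N.testBit j = true := by
  induction N using Nat.strong_induction_on with
  | _ N ih =>
    intro k
    rcases Nat.eq_zero_or_pos N with rfl | hN
    · rcases Nat.eq_zero_or_pos k with rfl | hk
      · simp
      · rw [Nat.choose_eq_zero_of_lt hk]
        simp only [Nat.zero_mod, zero_ne_one, Nat.zero_testBit, false_iff, Bool.false_eq_true]
        intro h
        exact hk.ne' (Nat.eq_of_testBit_eq fun i => by simpa using h i)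
    · rw [forall_nat_iff_zero_and_succ]
      obtain ⟨M, rfl | rfl⟩ := Nat.even_or_odd' N <;> obtain ⟨l, rfl | rfl⟩ := Nat.even_or_odd' k
      all_goals
        simp only [Nat.testBit_succ, Nat.testBit_zero, Nat.two_mul_add_one_div_two,
          Nat.mul_div_cancel_left _ (show 0 < 2 by norm_num), ← ih M (by omega) l]
      · have h1 := (Nat.two_mul_choose_mod_four M l).1
        unfold Nat.ModEq at h1
        simp
        omega
      · have h1 := (Nat.two_mul_choose_mod_four M l).2
        unfold Nat.ModEq at h1
        simp
        omega
      · cases l with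
        | zero => simp
        | succ l =>
          rw [show 2 * (l + 1) = 2 * l + 1 + 1 by ring, Nat.choose_succ_succ']
          have h1 := (Nat.two_mul_choose_mod_four M (l + 1)).1
          have h2 := (Nat.two_mul_choose_mod_four M l).2
          rw [show 2 * (l + 1) = 2 * l + 1 + 1 by ring] at h1
          unfold Nat.ModEq at h1 h2
          simp
          omega
      · rw [Nat.choose_succ_succ']
        have h1 := (Nat.two_mul_choose_mod_four M l).1
        have h2 := (Nat.two_mul_choose_mod_four M l).2
        unfold Nat.ModEq at h1 h2
        simp
        omega

/-- `C(N, k) ≡ 2 (mod 4)` holds iff `k` arises from a submask of `N` by moving exactly one digit `1`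
of `N` one place down, onto a digit `0`. -/
theorem Nat.choose_mod_four_eq_two_iff_testBit (N : ℕ) : ∀ k : ℕ,
    N.choose k % 4 = 2 ↔ ∃ p, (N.testBit (p + 1) = true ∧ N.testBit p = false) ∧
      (k.testBit (p + 1) = false ∧ k.testBit p = true) ∧
      ∀ j, j ≠ p → j ≠ p + 1 → k.testBit j = true → N.testBit j = true := by
  induction N using Nat.strong_induction_on with
  | _ N ih =>
    intro k
    rcases Nat.eq_zero_or_pos N with rfl | hN
    · rcases Nat.eq_zero_or_pos k with rfl | hk
      · simp
      · rw [Nat.choose_eq_zero_of_lt hk]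
        simp
    · rw [exists_nat_iff_zero_or_succ]
      have hsplit : ∀ p, (∀ j, j ≠ p + 1 → j ≠ p + 1 + 1 → k.testBit j = true → N.testBit j = true)
          ↔ (k.testBit 0 = true → N.testBit 0 = true) ∧
            ∀ j, j ≠ p → j ≠ p + 1 → (k / 2).testBit j = true → (N / 2).testBit j = true := by
        intro p
        rw [forall_nat_iff_zero_and_succ]
        simp [Nat.testBit_succ]
      have hsplit0 : (∀ j, j ≠ 0 → j ≠ 0 + 1 → k.testBit j = true → N.testBit j = true)
          ↔ ∀ j, (k / 2 / 2).testBit j = true → (N / 2 / 2).testBit j = true := by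
        rw [forall_nat_iff_zero_and_succ, forall_nat_iff_zero_and_succ]
        simp [Nat.testBit_succ]
      rw [hsplit0, ← Nat.choose_mod_two_eq_one_iff_testBit]
      simp only [hsplit]
      simp only [Nat.testBit_succ, Nat.testBit_zero, decide_eq_true_eq, decide_eq_false_iff_not]
      obtain ⟨M, rfl | rfl⟩ := Nat.even_or_odd' N <;> obtain ⟨l, rfl | rfl⟩ := Nat.even_or_odd' k
      all_goals
        simp only [Nat.two_mul_add_one_div_two,
          Nat.mul_div_cancel_left _ (show 0 < 2 by norm_num)]
      · have h1 := (Nat.two_mul_choose_mod_four M l).1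
        unfold Nat.ModEq at h1
        rw [h1, ih M (by omega) l]
        simp [Nat.testBit_succ]
      -- N even and k odd: the move must occur at p = 0. The binomial is 2M·C(M-1,l) modulo 4, so M
      -- must be odd and C(M-1,l) odd. As M-1 is then even, this means l even and C(M/2,l/2) odd.
      · have h1 := (Nat.two_mul_choose_mod_four M l).2
        have h3 : (l + 1) * M.choose (l + 1) = M * (M - 1).choose l := by
          cases M with
          | zero => omega
          | succ M => rw [mul_comm, ← Nat.add_one_mul_choose_eq]; simp
        rw [h3] at h1
        unfold Nat.ModEq at h1
        have h2 := Nat.mul_mod M ((M - 1).choose l) 2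
        rw [h1]
        simp
        rcases Nat.mod_two_eq_zero_or_one M with h | h
        · simp [h] at h2 ⊢; omega
        · have h6 : (2 * (M * (M - 1).choose l)) % 4 = 2 ↔ (M - 1).choose l % 2 = 1 := by
            simp [h] at h2; omega
          rw [h6, show M - 1 = 2 * (M / 2) by omega]
          simp only [h, true_and]
          generalize M / 2 = Q
          obtain ⟨q, rfl | rfl⟩ := Nat.even_or_odd' l
          · have h7 := (Nat.two_mul_choose_mod_four Q q).1
            unfold Nat.ModEq at h7
            simp
            omega
          · have h7 := (Nat.two_mul_choose_mod_four Q q).2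
            unfold Nat.ModEq at h7
            omega
      · rw [Nat.two_mul_add_one_choose_two_mul_mod_four, ih M (by omega) l]
        simp [Nat.testBit_succ]
      · rw [Nat.two_mul_add_one_choose_two_mul_add_one_mod_four, ih M (by omega) l]
        simp [Nat.testBit_succ]

/-! ### Binary rewriting and 2-adic valuations. -/

theorem Nat.exists_odd_eq_two_pow_padicValNat_mul {m : ℕ} (hm : m ≠ 0) :
    ∃ q, Odd q ∧ m = 2 ^ padicValNat 2 m * q := by
  obtain ⟨v, q, hq, h⟩ := Nat.exists_eq_two_pow_mul_odd hm
  have hv : padicValNat 2 m = v := by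
    rw [h, padicValNat.mul (by positivity) (by rintro rfl; simp at hq), padicValNat.prime_pow,
      padicValNat.eq_zero_of_not_dvd (by rwa [← even_iff_two_dvd, Nat.not_even_iff_odd]), add_zero]
  exact ⟨q, hq, hv ▸ h⟩

theorem Nat.testBit_padicValNat_two {m : ℕ} (hm : m ≠ 0) :
    m.testBit (padicValNat 2 m) = true := by
  obtain ⟨q, hq, h⟩ := Nat.exists_odd_eq_two_pow_padicValNat_mul hm
  generalize padicValNat 2 m = v at h
  rw [h, Nat.testBit_two_pow_mul]
  simpa using Nat.odd_iff.1 hq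

theorem Nat.testBit_eq_false_of_lt_padicValNat_two {m j : ℕ} (hj : j < padicValNat 2 m) :
    m.testBit j = false := by
  rcases eq_or_ne m 0 with rfl | hm
  · simp
  obtain ⟨q, hq, h⟩ := Nat.exists_odd_eq_two_pow_padicValNat_mul hm
  generalize padicValNat 2 m = v at h hj
  rw [h, Nat.testBit_two_pow_mul]
  simp [hj]

theorem binaryRewrite_iff (m k : ℕ) :
    BinaryRewrite m k ↔ padicValNat 2 m = padicValNat 2 k ∧ m.choose k % 4 = 2 := by
  rw [Nat.choose_mod_four_eq_two_iff_testBit]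
  constructor
  · rintro ⟨p, Z, hm, hk, hZ, hrest, hlow⟩
    refine ⟨?_, p, hm, hk, fun j hj hj' hkj => ?_⟩
    · have hm0 : m ≠ 0 := by rintro rfl; simp at hm
      have hk0 : k ≠ 0 := by rintro rfl; simp at hk
      have h1 := Nat.testBit_padicValNat_two hm0
      have h2 := Nat.testBit_padicValNat_two hk0
      rcases lt_trichotomy (padicValNat 2 m) (padicValNat 2 k) with h | h | h
      · have := Nat.testBit_eq_false_of_lt_padicValNat_two h
        rw [hlow _ le_rfl, h1] at this
        cases this
      · exact h
      · have := Nat.testBit_eq_false_of_lt_padicValNat_two h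
        rw [← hlow _ h.le, h2] at this
        cases this
    · by_cases hjZ : j ∈ Z
      · exact (hZ j hjZ).2.2.1
      · rw [← hrest j hjZ hj hj', hkj]
  · rintro ⟨hv, p, hm, hk, hrest⟩
    have hm0 : m ≠ 0 := by rintro rfl; simp at hm
    have hk0 : k ≠ 0 := by rintro rfl; simp at hk
    -- The range bound loses nothing: a digit 1 at j gives j < 2^j ≤ m.
    refine ⟨p, (Finset.range m).filter fun j =>
      j ≠ p ∧ j ≠ p + 1 ∧ m.testBit j = true ∧ k.testBit j = false, hm, hk,
      fun j hj => (Finset.mem_filter.1 hj).2, fun j hj hp hp' => ?_, fun j hj => ?_⟩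
    · cases hkj : k.testBit j
      · cases hmj : m.testBit j
        · rfl
        · refine absurd (Finset.mem_filter.2 ⟨Finset.mem_range.2 ?_, hp, hp', hmj, hkj⟩) hj
          exact lt_of_lt_of_le Nat.lt_two_pow_self (Nat.ge_two_pow_of_testBit hmj)
      · rw [hrest j hp hp' hkj]
    · rcases hj.lt_or_eq with h | rfl
      · rw [Nat.testBit_eq_false_of_lt_padicValNat_two h,
          Nat.testBit_eq_false_of_lt_padicValNat_two (hv ▸ h)]
      · rw [Nat.testBit_padicValNat_two hm0, hv, Nat.testBit_padicValNat_two hk0]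

/-- The moved `10` lies above the lowest digit 1 of m, so the ones of m do not form a single run. -/
theorem BinaryRewrite.ne_two_pow_mul {m k : ℕ} (h : BinaryRewrite m k) (a b : ℕ) :
    m ≠ 2 ^ a * (2 ^ b - 1) := by
  rintro rfl
  obtain ⟨p, Z, hm, hk, -, -, hlow⟩ := h
  have hm0 : 2 ^ a * (2 ^ b - 1) ≠ 0 := by intro h; simp [h] at hm
  have hp : padicValNat 2 (2 ^ a * (2 ^ b - 1)) < p := by
    by_contra! h
    rw [hlow p h, hm.2] at hk
    simp at hk
  have h1 := Nat.testBit_padicValNat_two hm0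
  generalize padicValNat 2 (2 ^ a * (2 ^ b - 1)) = v at *
  rw [Nat.testBit_two_pow_mul, Nat.testBit_two_pow_sub_one] at h1 hm
  rw [Nat.testBit_two_pow_mul, Nat.testBit_two_pow_sub_one] at hm
  simp at h1 hm
  omega

/-- By Pascal, the left side says that C(N-1,k-1) has valuation 1; compare valuations in
N·C(N-1,k-1) = k·C(N,k), where C(N,k) has valuation 1. -/
theorem Nat.choose_pred_mod_four_iff {N k : ℕ} (h : N.choose k % 4 = 2) (hk : Even k) :
    (N - 1).choose k % 4 = 0 ↔ Even N ∧ padicValNat 2 N = padicValNat 2 k := by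
  have hN : N ≠ 0 := by rintro rfl; cases k <;> simp at h
  have hk0 : k ≠ 0 := by rintro rfl; simp at h
  have hkN : k < N := by
    by_contra! hle
    rcases hle.eq_or_lt with rfl | hlt
    · simp at h
    · simp [Nat.choose_eq_zero_of_lt hlt] at h
  have key : N * (N - 1).choose (k - 1) = N.choose k * k := by
    obtain ⟨M, rfl⟩ := Nat.exists_eq_succ_of_ne_zero hN
    obtain ⟨l, rfl⟩ := Nat.exists_eq_succ_of_ne_zero hk0
    exact Nat.add_one_mul_choose_eq _ _
  have hpascal : N.choose k = (N - 1).choose (k - 1) + (N - 1).choose k := by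
    obtain ⟨M, rfl⟩ := Nat.exists_eq_succ_of_ne_zero hN
    obtain ⟨l, rfl⟩ := Nat.exists_eq_succ_of_ne_zero hk0
    exact Nat.choose_succ_succ _ _
  have hiff : (N - 1).choose k % 4 = 0 ↔ (N - 1).choose (k - 1) % 4 = 2 := by omega
  have hval : ∀ c : ℕ, c % 4 = 2 ↔ c ≠ 0 ∧ padicValNat 2 c = 1 := by
    intro c
    rcases eq_or_ne c 0 with rfl | hc
    · simp
    have h1 := padicValNat_dvd_iff_le (p := 2) hc (n := 1)
    have h2 := padicValNat_dvd_iff_le (p := 2) hc (n := 2)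
    norm_num at h1 h2
    omega
  have hc0 : (N - 1).choose (k - 1) ≠ 0 := (Nat.choose_pos (by omega)).ne'
  have hv := congrArg (padicValNat 2) key
  rw [padicValNat.mul hN hc0, padicValNat.mul ((hval _).1 h).1 hk0, ((hval _).1 h).2] at hv
  rw [hiff, hval]
  have hk2 : 1 ≤ padicValNat 2 k := one_le_padicValNat_of_dvd hk0 hk.two_dvd
  constructor
  · rintro ⟨-, h1⟩
    have h2 : padicValNat 2 N = padicValNat 2 k := by omega
    refine ⟨even_iff_two_dvd.2 (dvd_of_one_le_padicValNat (by omega)), h2⟩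
  · rintro ⟨-, h2⟩
    exact ⟨hc0, by omega⟩

/-! ### Krawtchouk numbers and their congruences. -/

noncomputable section

open Polynomial in
/-- The value at `j` of the `r`-th binary Krawtchouk polynomial with parameter `n`. -/
def krawtchouk (n r j : ℕ) : ℤ :=
  ((1 - X) ^ j * (1 + X) ^ (n - j) : ℤ[X]).coeff r

theorem krawtchouk_zero (n r : ℕ) : krawtchouk n r 0 = n.choose r := by
  simp [krawtchouk, Polynomial.coeff_one_add_X_pow]

open Polynomial in
-- From (1+X) - (1-X) = 2X; the two-step version uses (1+X)² - (1-X)² = 4X.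
theorem krawtchouk_sub_succ {m j : ℕ} (r : ℕ) (h : j ≤ m) :
    krawtchouk (m + 1) (r + 1) j - krawtchouk (m + 1) (r + 1) (j + 1) = 2 * krawtchouk m r j := by
  obtain ⟨d, rfl⟩ := Nat.exists_eq_add_of_le h
  simp only [krawtchouk]
  rw [← Polynomial.coeff_sub, show j + d + 1 - j = d + 1 by omega,
    show j + d + 1 - (j + 1) = d by omega, show j + d - j = d by omega,
    ← Polynomial.coeff_C_mul, ← Polynomial.coeff_mul_X (C 2 * _)]
  congr 1
  rw [show (C 2 : ℤ[X]) = 2 from rfl]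
  ring

open Polynomial in
theorem krawtchouk_sub_add_two {m j : ℕ} (r : ℕ) (h : j ≤ m) :
    krawtchouk (m + 2) (r + 1) j - krawtchouk (m + 2) (r + 1) (j + 2) = 4 * krawtchouk m r j := by
  obtain ⟨d, rfl⟩ := Nat.exists_eq_add_of_le h
  simp only [krawtchouk]
  rw [← Polynomial.coeff_sub, show j + d + 2 - j = d + 2 by omega,
    show j + d + 2 - (j + 2) = d by omega, show j + d - j = d by omega,
    ← Polynomial.coeff_C_mul, ← Polynomial.coeff_mul_X (C 4 * _)]
  congr 1
  rw [show (C 4 : ℤ[X]) = 4 from rfl]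
  ring

theorem two_dvd_krawtchouk {m r : ℕ} (h : Even (m.choose (r + 1))) :
    ∀ {j : ℕ}, j ≤ m → 2 ∣ krawtchouk m (r + 1) j
  | 0, _ => by rw [krawtchouk_zero]; exact_mod_cast h.two_dvd
  | j + 1, hj => by
    obtain ⟨m, rfl⟩ : ∃ m', m = m' + 1 := ⟨m - 1, by omega⟩
    have h1 := two_dvd_krawtchouk h (j := j) (by omega)
    have h2 := krawtchouk_sub_succ r (show j ≤ m by omega)
    omega

theorem four_dvd_krawtchouk {m r : ℕ} (h : 4 ∣ (m + 1).choose (r + 2))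
    (h' : Even (m.choose (r + 1))) :
    ∀ {j : ℕ}, j ≤ m + 1 → 4 ∣ krawtchouk (m + 1) (r + 2) j
  | 0, _ => by rw [krawtchouk_zero]; exact_mod_cast h
  | j + 1, hj => by
    have h1 := four_dvd_krawtchouk h h' (j := j) (by omega)
    have h2 := krawtchouk_sub_succ (r + 1) (show j ≤ m by omega)
    have h3 := two_dvd_krawtchouk h' (show j ≤ m by omega)
    rw [show r + 1 + 1 = r + 2 from rfl] at h2
    omega

/-- The congruences between the eigenvalues of `hammingGraph n r` that amount to balanced
fractional revival at time `π / 8`. -/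
theorem odd_and_krawtchouk_congruences_iff (N k : ℕ) :
    (Odd (k + 1) ∧ (krawtchouk (N + 1) (k + 1) 0 - krawtchouk (N + 1) (k + 1) 1) % 8 = 4 ∧
      ∀ j, j + 2 ≤ N + 1 →
        16 ∣ krawtchouk (N + 1) (k + 1) j - krawtchouk (N + 1) (k + 1) (j + 2)) ↔
    (Odd (N + 1) ∧ padicValNat 2 N = padicValNat 2 k ∧ N.choose k % 4 = 2) := by
  have h0 := krawtchouk_sub_succ k (Nat.zero_le N)
  rw [krawtchouk_zero N k, zero_add] at h0
  rw [h0]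
  constructor
  · rintro ⟨hk, h1, h2⟩
    have hc : N.choose k % 4 = 2 := by omega
    have hke : Even k := by rw [Nat.odd_iff] at hk; rw [Nat.even_iff]; omega
    cases N with
    | zero => cases k <;> simp at hc
    | succ M =>
      have h3 := h2 0 (by omega)
      have h4 := krawtchouk_sub_add_two k (Nat.zero_le M)
      rw [krawtchouk_zero M k] at h4
      rw [show M + 1 + 1 = M + 2 from rfl, h4] at h3
      obtain ⟨h5, h6⟩ := (Nat.choose_pred_mod_four_iff hc hke).1 (by
        rw [Nat.add_sub_cancel]; omega)
      exact ⟨h5.add_one, h6, hc⟩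
  · rintro ⟨hN, hv, hc⟩
    have hNe : Even N := by rw [Nat.odd_iff] at hN; rw [Nat.even_iff]; omega
    have hN0 : N ≠ 0 := by rintro rfl; cases k <;> simp at hc
    have hk0 : k ≠ 0 := by rintro rfl; simp at hc
    have hke : Even k := by
      rw [even_iff_two_dvd]
      apply dvd_of_one_le_padicValNat
      rw [← hv]
      exact one_le_padicValNat_of_dvd hN0 hNe.two_dvd
    refine ⟨hke.add_one, by omega, fun j hj => ?_⟩
    have h4 := (Nat.choose_pred_mod_four_iff hc hke).2 ⟨hNe, hv⟩
    obtain ⟨M, rfl⟩ : ∃ M, N = 2 * M + 2 := ⟨N / 2 - 1, by rw [Nat.even_iff] at hNe; omega⟩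
    obtain ⟨l, rfl⟩ : ∃ l, k = 2 * l + 2 := ⟨k / 2 - 1, by rw [Nat.even_iff] at hke; omega⟩
    have h5 := (Nat.two_mul_choose_mod_four M l).2
    unfold Nat.ModEq at h5
    -- The parity hypothesis is free: C(2M,2l+1) is always even.
    have h6 := four_dvd_krawtchouk (m := 2 * M) (r := 2 * l) (Nat.dvd_of_mod_eq_zero h4)
      (by rw [Nat.even_iff]; omega) (j := j) (by omega)
    have h7 := krawtchouk_sub_add_two (2 * l + 2) (show j ≤ 2 * M + 1 by omega)
    rw [show 2 * M + 2 + 1 = 2 * M + 1 + 2 from rfl, h7]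
    omega

/-! ### Characters of the binary cube and diagonalisation. -/

section BooleanCube

variable {n : ℕ}

/-- The number of digits `1` of a binary sequence. -/
def binaryWeight (c : Fin n → Bool) : ℕ := (Finset.univ.filter fun i => c i = true).card

/-- The characters of the group of binary sequences. -/
def cubeChar (s x : Fin n → Bool) : ℤ := ∏ i, if s i && x i then -1 else 1

theorem cubeChar_comm (s x : Fin n → Bool) : cubeChar s x = cubeChar x s := by
  simp only [cubeChar, Bool.and_comm]

/-- Addition on `Bool` is exclusive or. -/
theorem cubeChar_add (s x y : Fin n → Bool) :
    cubeChar s (x + y) = cubeChar s x * cubeChar s y := by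
  simp only [cubeChar, ← Finset.prod_mul_distrib]
  refine Finset.prod_congr rfl fun i _ => ?_
  rw [Pi.add_apply]
  generalize s i = a
  generalize x i = b
  generalize y i = c
  revert a b c
  decide

theorem cubeChar_zero (s : Fin n → Bool) : cubeChar s 0 = 1 := by
  refine Finset.prod_eq_one fun i _ => ?_
  rw [Pi.zero_apply]
  generalize s i = a
  revert a
  decide

theorem cubeChar_one (s : Fin n → Bool) : cubeChar s 1 = (-1) ^ binaryWeight s := by
  rw [cubeChar, binaryWeight, ← Finset.prod_const, ← Finset.prod_filter_mul_prod_filter_not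
    Finset.univ (fun i => s i = true)]
  rw [Finset.prod_congr rfl (g := fun _ => (-1 : ℤ)), Finset.prod_eq_one
    (s := Finset.univ.filter fun i => ¬ s i = true), mul_one]
  · intro i hi
    simp [(Finset.mem_filter.1 hi).2]
  · intro i hi
    rw [(Finset.mem_filter.1 hi).2, Pi.one_apply]
    decide

theorem hammingDist_add_right (x c : Fin n → Bool) : hammingDist x (x + c) = binaryWeight c := by
  rw [hammingDist, binaryWeight]
  congr 1
  refine Finset.filter_congr fun i _ => ?_
  rw [Pi.add_apply]
  generalize x i = a
  generalize c i = b
  revert a b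
  decide

theorem hammingGraph_adj_add {r : ℕ} (hr : 1 ≤ r) (x c : Fin n → Bool) :
    (hammingGraph n r).Adj x (x + c) ↔ binaryWeight c = r := by
  change x ≠ x + c ∧ hammingDist x (x + c) = r ↔ _
  rw [hammingDist_add_right]
  refine ⟨And.right, fun h => ⟨fun hx => ?_, h⟩⟩
  have := hammingDist_add_right x c
  rw [← hx, hammingDist_self] at this
  omega

open Polynomial in
-- The sum factors over coordinates, with factor 1-X or 1+X. Coefficients give the eigenvalues;
-- evaluation at 1 gives orthogonality.
theorem sum_cubeChar_mul_X_pow (s : Fin n → Bool) :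
    ∑ c, C (cubeChar s c) * X ^ binaryWeight c =
      ((1 - X) ^ binaryWeight s * (1 + X) ^ (n - binaryWeight s) : ℤ[X]) := by
  have h1 : ∀ c : Fin n → Bool, (C (cubeChar s c) * X ^ binaryWeight c : ℤ[X]) =
      ∏ i, if c i then (if s i then -X else X) else 1 := by
    intro c
    have : (X ^ binaryWeight c : ℤ[X]) = ∏ i, if c i then X else 1 := by
      rw [binaryWeight, ← Finset.prod_const, Finset.prod_filter]
    rw [this, cubeChar, map_prod, ← Finset.prod_mul_distrib]
    refine Finset.prod_congr rfl fun i _ => ?_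
    cases c i <;> cases s i <;> simp
  simp only [h1]
  have h2 := Finset.prod_univ_sum (fun _ : Fin n => (Finset.univ : Finset Bool))
    (fun i b => if b then (if s i then -X else X) else (1 : ℤ[X]))
  rw [Fintype.piFinset_univ] at h2
  rw [← h2]
  have h3 : ∀ i, (∑ b : Bool, if b then (if s i then -X else X) else (1 : ℤ[X])) =
      if s i = true then 1 - X else 1 + X := by
    intro i
    cases s i <;> simp <;> ring
  simp only [h3]
  rw [Finset.prod_ite, Finset.prod_const, Finset.prod_const, binaryWeight]
  congr 2
  have := Finset.card_filter_add_card_filter_not (s := (Finset.univ : Finset (Fin n)))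
    (fun i => s i = true)
  rw [Finset.card_univ, Fintype.card_fin] at this
  omega

theorem sum_cubeChar_of_weight (r : ℕ) (s : Fin n → Bool) :
    (∑ c, if binaryWeight c = r then cubeChar s c else 0) =
      krawtchouk n r (binaryWeight s) := by
  rw [krawtchouk, ← sum_cubeChar_mul_X_pow, Polynomial.finsetSum_coeff]
  refine Finset.sum_congr rfl fun c _ => ?_
  rw [Polynomial.coeff_C_mul, Polynomial.coeff_X_pow]
  simp [eq_comm]

theorem binaryWeight_eq_zero {c : Fin n → Bool} : binaryWeight c = 0 ↔ c = 0 := by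
  rw [binaryWeight, Finset.card_eq_zero, Finset.filter_eq_empty_iff]
  constructor
  · intro h
    funext i
    exact Bool.eq_false_iff.2 (h (Finset.mem_univ i))
  · rintro rfl i - h
    cases h

theorem sum_cubeChar (s : Fin n → Bool) : ∑ c, cubeChar s c = if s = 0 then 2 ^ n else 0 := by
  have h := congrArg (Polynomial.eval 1) (sum_cubeChar_mul_X_pow s)
  simp only [Polynomial.eval_finsetSum, Polynomial.eval_mul, Polynomial.eval_pow,
    Polynomial.eval_X, Polynomial.eval_C, one_pow, mul_one, Polynomial.eval_sub,
    Polynomial.eval_add, Polynomial.eval_one, sub_self] at h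
  rw [h]
  split_ifs with hs
  · rw [binaryWeight_eq_zero.2 hs]
    norm_num
  · rw [zero_pow (mt binaryWeight_eq_zero.1 hs), zero_mul]

theorem exists_binaryWeight_eq {j : ℕ} (h : j ≤ n) : ∃ s : Fin n → Bool, binaryWeight s = j := by
  obtain ⟨t, -, ht⟩ := Finset.exists_subset_card_eq (s := (Finset.univ : Finset (Fin n)))
    (n := j) (by simpa using h)
  exact ⟨fun i => decide (i ∈ t), by simp [binaryWeight, ht]⟩

theorem cube_add_self (x : Fin n → Bool) : x + x = 0 := by
  funext i
  rw [Pi.add_apply, Pi.zero_apply]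
  generalize x i = a
  revert a
  decide

theorem cube_add_cancel_left (x y : Fin n → Bool) : x + (x + y) = y := by
  rw [← add_assoc, cube_add_self, zero_add]

/-- The matrix whose rows are the characters of the group of binary sequences. -/
def cubeCharMatrix (n : ℕ) : Matrix (Fin n → Bool) (Fin n → Bool) ℂ :=
  Matrix.of fun s x => (cubeChar s x : ℂ)

theorem cubeCharMatrix_mul_self : cubeCharMatrix n * cubeCharMatrix n = (2 ^ n : ℂ) • 1 := by
  ext s t
  rw [Matrix.mul_apply]
  have h : ∀ x, cubeCharMatrix n s x * cubeCharMatrix n x t = (cubeChar (s + t) x : ℂ) := by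
    intro x
    rw [cubeCharMatrix, Matrix.of_apply, Matrix.of_apply, cubeChar_comm s x, cubeChar_comm _ x,
      cubeChar_add]
    push_cast
    rfl
  simp only [h]
  rw [← Int.cast_sum, sum_cubeChar, Matrix.smul_apply, Matrix.one_apply]
  have : s + t = 0 ↔ s = t :=
    ⟨fun h => by rw [← cube_add_cancel_left s t, h, add_zero], fun h => by rw [h, cube_add_self]⟩
  simp [this]

theorem isUnit_cubeCharMatrix : IsUnit (cubeCharMatrix n) := by
  refine IsUnit.of_mul_eq_one (((2 ^ n : ℂ)⁻¹) • cubeCharMatrix n) ?_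
  rw [Matrix.mul_smul, cubeCharMatrix_mul_self, smul_smul, inv_mul_cancel₀ (pow_ne_zero _ two_ne_zero),
    one_smul]

open Classical in
theorem cubeCharMatrix_mul_adjMatrix {r : ℕ} (hr : 1 ≤ r) :
    cubeCharMatrix n * (hammingGraph n r).adjMatrix ℂ =
      Matrix.diagonal (fun s => (krawtchouk n r (binaryWeight s) : ℂ)) * cubeCharMatrix n := by
  ext s x
  rw [Matrix.mul_apply, Matrix.diagonal_mul, ← Equiv.sum_comp (Equiv.addLeft x)]
  have h : ∀ c, cubeCharMatrix n s (Equiv.addLeft x c) *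
      (hammingGraph n r).adjMatrix ℂ (Equiv.addLeft x c) x =
      (((if binaryWeight c = r then cubeChar s c else 0) : ℤ) : ℂ) * cubeChar s x := by
    intro c
    rw [SimpleGraph.adjMatrix_apply, SimpleGraph.adj_comm, Equiv.coe_addLeft,
      hammingGraph_adj_add hr, cubeCharMatrix, Matrix.of_apply, cubeChar_add]
    split_ifs <;> push_cast <;> ring
  simp only [h]
  rw [← Finset.sum_mul, ← Int.cast_sum, sum_cubeChar_of_weight]
  rfl

theorem cubeCharMatrix_mul_transitionMatrix {r : ℕ} (hr : 1 ≤ r) (t : ℝ) :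
    cubeCharMatrix n * transitionMatrix (hammingGraph n r) t =
      Matrix.diagonal (fun s =>
        Complex.exp (-(Complex.I * t) * krawtchouk n r (binaryWeight s))) * cubeCharMatrix n := by
  classical
  have hU := (Matrix.isUnit_iff_isUnit_det _).1 (isUnit_cubeCharMatrix (n := n))
  have h1 := Matrix.exp_conj (cubeCharMatrix n)
    ((-(Complex.I * (t : ℂ))) • (hammingGraph n r).adjMatrix ℂ) isUnit_cubeCharMatrix
  rw [Matrix.mul_smul, cubeCharMatrix_mul_adjMatrix hr, Matrix.smul_mul, Matrix.mul_assoc,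
    Matrix.mul_nonsing_inv _ hU, Matrix.mul_one, ← Matrix.diagonal_smul, Matrix.exp_diagonal] at h1
  have h2 := congrArg (· * cubeCharMatrix n) h1
  simp only [Matrix.mul_assoc, Matrix.nonsing_inv_mul _ hU, Matrix.mul_one] at h2
  have h3 : NormedSpace.exp (-(Complex.I * (t : ℂ)) •
      fun s : Fin n → Bool => (krawtchouk n r (binaryWeight s) : ℂ)) =
      fun s => Complex.exp (-(Complex.I * t) * krawtchouk n r (binaryWeight s)) := by
    funext s
    rw [Pi.coe_exp, ← Complex.exp_eq_exp_ℂ]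
    simp
  rw [h3] at h2
  exact h2.symm

theorem transitionMatrix_mulVec_single_eq_iff {r : ℕ} (hr : 1 ≤ r) (t : ℝ) (α β : ℂ)
    (a b : Fin n → Bool) :
    transitionMatrix (hammingGraph n r) t *ᵥ (Pi.single a 1 : (Fin n → Bool) → ℂ) =
      α • (Pi.single a 1 : (Fin n → Bool) → ℂ) + β • (Pi.single b 1 : (Fin n → Bool) → ℂ) ↔
    ∀ s, Complex.exp (-(Complex.I * t) * krawtchouk n r (binaryWeight s)) * cubeChar s a =
      α * cubeChar s a + β * cubeChar s b := by
  rw [← (Matrix.mulVec_injective_of_isUnit (isUnit_cubeCharMatrix (n := n))).eq_iff,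
    Matrix.mulVec_mulVec, cubeCharMatrix_mul_transitionMatrix hr, ← Matrix.mulVec_mulVec,
    funext_iff]
  simp [Matrix.mulVec_add, Matrix.mulVec_smul, Matrix.mulVec_diagonal, cubeCharMatrix,
    Matrix.mulVec_single]

end BooleanCube

/-! ### Phases at time π/8. -/

/-- The number `exp(-iπθ/8)`. -/
def phase (θ : ℤ) : ℂ := Complex.exp (-(Complex.I * (Real.pi / 8 : ℝ)) * θ)

theorem phase_eq_phase_iff (a b : ℤ) : phase a = phase b ↔ 16 ∣ a - b := by
  rw [phase, phase, Complex.exp_eq_exp_iff_exists_int]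
  have hpi : (Real.pi : ℂ) ≠ 0 := by exact_mod_cast Real.pi_ne_zero
  constructor
  · rintro ⟨m, hm⟩
    refine ⟨-m, ?_⟩
    have : (Complex.I * Real.pi) * ((a - b : ℤ) : ℂ) =
        (Complex.I * Real.pi) * ((16 * -m : ℤ) : ℂ) := by
      push_cast at hm ⊢
      linear_combination (-8 : ℂ) * hm
    exact_mod_cast mul_left_cancel₀ (mul_ne_zero Complex.I_ne_zero hpi) this
  · rintro ⟨m, hm⟩
    refine ⟨-m, ?_⟩
    obtain rfl : a = b + 16 * m := by omega
    push_cast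
    ring

theorem phase_eq (θ : ℤ) : phase θ =
    ⟨Real.cos (Real.pi / 8 * θ), -Real.sin (Real.pi / 8 * θ)⟩ := by
  have : phase θ = Complex.exp (((-(Real.pi / 8 * θ) : ℝ) : ℂ) * Complex.I) := by
    rw [phase]
    congr 1
    push_cast
    ring
  rw [this]
  apply Complex.ext
  · rw [Complex.exp_ofReal_mul_I_re, Real.cos_neg]
  · rw [Complex.exp_ofReal_mul_I_im, Real.sin_neg]

theorem norm_phase_add_sq (a b : ℤ) :
    ‖phase a + phase b‖ ^ 2 = 2 + 2 * Real.cos (Real.pi / 8 * (a - b : ℤ)) := by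
  rw [← Complex.normSq_eq_norm_sq, phase_eq, phase_eq, Complex.normSq_apply]
  simp only [Complex.add_re, Complex.add_im]
  push_cast
  rw [mul_sub (Real.pi / 8), Real.cos_sub]
  linear_combination Real.sin_sq_add_cos_sq (Real.pi / 8 * a) +
    Real.sin_sq_add_cos_sq (Real.pi / 8 * b)

theorem norm_phase_sub_sq (a b : ℤ) :
    ‖phase a - phase b‖ ^ 2 = 2 - 2 * Real.cos (Real.pi / 8 * (a - b : ℤ)) := by
  rw [← Complex.normSq_eq_norm_sq, phase_eq, phase_eq, Complex.normSq_apply]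
  simp only [Complex.sub_re, Complex.sub_im]
  push_cast
  rw [mul_sub (Real.pi / 8), Real.cos_sub]
  linear_combination Real.sin_sq_add_cos_sq (Real.pi / 8 * a) +
    Real.sin_sq_add_cos_sq (Real.pi / 8 * b)

theorem cos_pi_div_eight_mul_eq_zero_iff (d : ℤ) :
    Real.cos (Real.pi / 8 * d) = 0 ↔ d % 8 = 4 := by
  rw [Real.cos_eq_zero_iff]
  constructor
  · rintro ⟨k, hk⟩
    have : Real.pi * (d : ℝ) = Real.pi * ((4 * (2 * k + 1) : ℤ) : ℝ) := by
      push_cast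
      linear_combination 8 * hk
    have : d = 4 * (2 * k + 1) := by exact_mod_cast mul_left_cancel₀ Real.pi_ne_zero this
    omega
  · intro h
    refine ⟨d / 8, ?_⟩
    have : d = 4 * (2 * (d / 8) + 1) := by omega
    have h' : (d : ℝ) = 4 * (2 * ((d / 8 : ℤ) : ℝ) + 1) := by exact_mod_cast this
    linear_combination Real.pi / 8 * h'

theorem one_div_sqrt_two_sq : (1 / √2 : ℝ) ^ 2 = 1 / 2 := by
  rw [div_pow, one_pow, Real.sq_sqrt zero_le_two]

theorem eq_one_div_sqrt_two_iff {x : ℝ} (hx : 0 ≤ x) : x = 1 / √2 ↔ x ^ 2 = 1 / 2 := by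
  rw [← one_div_sqrt_two_sq, sq_eq_sq₀ hx (by positivity)]

/-- Phases that alternate between two values come from a balanced pair `α`, `β`. -/
theorem exists_balanced_iff {n : ℕ} (hn : 1 ≤ n) (θ : ℕ → ℤ) :
    (∃ α β : ℂ, ‖α‖ = 1 / √2 ∧ ‖β‖ = 1 / √2 ∧ ∀ j ≤ n, phase (θ j) = α + β * (-1) ^ j) ↔
      (θ 0 - θ 1) % 8 = 4 ∧ ∀ j, j + 2 ≤ n → 16 ∣ θ j - θ (j + 2) := by
  constructor
  · rintro ⟨α, β, hα, -, h⟩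
    refine ⟨?_, fun j hj => ?_⟩
    · have h1 : phase (θ 0) + phase (θ 1) = 2 * α := by
        rw [h 0 (by omega), h 1 hn]
        ring
      have h2 := norm_phase_add_sq (θ 0) (θ 1)
      rw [h1, norm_mul, mul_pow, hα, one_div_sqrt_two_sq, Complex.norm_two] at h2
      rw [← cos_pi_div_eight_mul_eq_zero_iff]
      linarith
    · rw [← phase_eq_phase_iff, h j (by omega), h (j + 2) hj]
      ring
  · rintro ⟨h1, h2⟩
    rw [← cos_pi_div_eight_mul_eq_zero_iff] at h1
    -- The unique solution of the equations for j = 0, 1; the vanishing cosine makes both moduli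
    -- 1/√2.
    refine ⟨(phase (θ 0) + phase (θ 1)) / 2, (phase (θ 0) - phase (θ 1)) / 2, ?_, ?_, ?_⟩
    · rw [eq_one_div_sqrt_two_iff (norm_nonneg _), norm_div, div_pow, norm_phase_add_sq, h1,
        Complex.norm_two]
      norm_num
    · rw [eq_one_div_sqrt_two_iff (norm_nonneg _), norm_div, div_pow, norm_phase_sub_sq, h1,
        Complex.norm_two]
      norm_num
    · intro j
      induction j using Nat.twoStepInduction with
      | zero => intro _; ring
      | one => intro _; ring
      | more j ih _ =>
        intro hj
        rw [← (phase_eq_phase_iff _ _).2 (h2 j hj), ih (by omega)]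
        ring

/-! ### Revival and connectedness on the cube. -/

section BooleanCube

variable {n : ℕ}

theorem cubeChar_single (i : Fin n) (x : Fin n → Bool) :
    cubeChar (Pi.single i 1) x = if x i then -1 else 1 := by
  rw [cubeChar, Finset.prod_eq_single i]
  · rw [Pi.single_eq_same]
    cases x i <;> decide
  · intro j _ hj
    rw [Pi.single_eq_of_ne hj]
    cases x j <;> decide
  · simp

theorem binaryWeight_ite_mem (S : Finset (Fin n)) :
    binaryWeight (fun k => if k ∈ S then (1 : Bool) else 0) = S.card := by
  rw [binaryWeight]
  congr 1
  ext i
  by_cases h : i ∈ S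
  · simp only [h, if_true, Finset.mem_filter, Finset.mem_univ, true_and, iff_true]
    rfl
  · simp [h]

theorem binaryWeight_single (i : Fin n) : binaryWeight (Pi.single i (1 : Bool)) = 1 := by
  have : (Pi.single i (1 : Bool) : Fin n → Bool) =
      fun k => if k ∈ ({i} : Finset (Fin n)) then 1 else 0 := by
    funext k
    simp [Pi.single_apply]
  rw [this, binaryWeight_ite_mem, Finset.card_singleton]

theorem hasBalancedRevival_hammingGraph_iff {r : ℕ} (hn : 1 ≤ n) (hr : 1 ≤ r) :
    HasBalancedRevival (hammingGraph n r) (Real.pi / 8) ↔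
      ∃ α β : ℂ, ‖α‖ = 1 / √2 ∧ ‖β‖ = 1 / √2 ∧
        ∀ j ≤ n, phase (krawtchouk n r j) = α + β * (-1) ^ j := by
  refine exists_congr fun α => exists_congr fun β =>
    and_congr_right fun hα => and_congr_right fun hβ => ?_
  have hβ0 : β ≠ 0 := by
    rintro rfl
    rw [norm_zero] at hβ
    have : (0 : ℝ) < 1 / √2 := by positivity
    exact this.ne hβ
  constructor
  · intro h
    obtain ⟨b, hb, -, -, -, hU⟩ := h 0
    rw [transitionMatrix_mulVec_single_eq_iff hr] at hU
    have hU' : ∀ s, phase (krawtchouk n r (binaryWeight s)) = α + β * (cubeChar s b : ℂ) := by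
      intro s
      simpa [cubeChar_zero, phase] using hU s
    -- The phase depends only on the weight of s, so all weight-1 characters agree at b: its digits
    -- are equal, and b ≠ 0.
    have hb1 : b = 1 := by
      obtain ⟨i, hi⟩ := Function.ne_iff.1 hb.symm
      have hi' : b i = true := by
        rw [Pi.zero_apply] at hi
        exact Bool.eq_true_of_not_eq_false hi
      funext k
      have h1 := hU' (Pi.single i 1)
      have h2 := hU' (Pi.single k 1)
      rw [binaryWeight_single, cubeChar_single] at h1 h2
      rw [h1] at h2
      have h3 := mul_left_cancel₀ hβ0 (add_left_cancel h2)
      rw [hi'] at h3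
      by_contra hk
      have hk' : b k = false := Bool.eq_false_iff.2 hk
      rw [hk'] at h3
      norm_num at h3
    intro j hj
    obtain ⟨s, rfl⟩ := exists_binaryWeight_eq hj
    rw [hU', hb1, cubeChar_one]
    push_cast
    rfl
  · intro h a
    refine ⟨a + 1, fun ha => ?_, by positivity, hβ0, ?_, ?_⟩
    · have : (1 : Fin n → Bool) = 0 := by
        rw [← cube_add_cancel_left a 1, ← ha, cube_add_self]
      have := congrFun this ⟨0, hn⟩
      rw [Pi.one_apply, Pi.zero_apply] at this
      revert this
      decide
    · rw [hα, hβ, one_div_sqrt_two_sq]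
      norm_num
    · rw [transitionMatrix_mulVec_single_eq_iff hr]
      intro s
      have hs : binaryWeight s ≤ n := by
        simpa [binaryWeight] using Finset.card_filter_le (Finset.univ : Finset (Fin n)) fun i => s i = true
      change phase _ * _ = _
      rw [h _ hs, cubeChar_add, cubeChar_one]
      push_cast
      ring

/-- For even r, edges preserve the parity of the weight. -/
theorem odd_of_connected_hammingGraph {r : ℕ} (hn : 1 ≤ n) (hr : 1 ≤ r)
    (h : (hammingGraph n r).Connected) : Odd r := by
  by_contra hodd
  have hadj : ∀ x y, (hammingGraph n r).Adj x y → cubeChar x 1 = cubeChar y 1 := by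
    intro x y hxy
    rw [← cube_add_cancel_left x y, hammingGraph_adj_add hr] at hxy
    rw [← cube_add_cancel_left x y, cubeChar_comm (x + (x + y)), cubeChar_add _ x,
      cubeChar_comm 1 x, cubeChar_comm 1 (x + y), cubeChar_one (x + y), hxy,
      (Nat.not_odd_iff_even.1 hodd).neg_one_pow, mul_one]
  obtain ⟨w⟩ := h.preconnected (0 : Fin n → Bool) (Pi.single ⟨0, hn⟩ 1)
  have hw : ∀ x y, (hammingGraph n r).Walk x y → cubeChar x 1 = cubeChar y 1 := by
    intro x y w
    induction w with
    | nil => rfl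
    | cons hxy _ ih => exact (hadj _ _ hxy).trans ih
  have h1 := hw _ _ w
  rw [cubeChar_comm 0, cubeChar_zero, cubeChar_one, binaryWeight_single] at h1
  norm_num at h1

/-- The translations of the binary cube that stay inside the components of `hammingGraph n r`. -/
def reachableTranslations (n r : ℕ) : AddSubmonoid (Fin n → Bool) where
  carrier := {c | ∀ x, (hammingGraph n r).Reachable x (x + c)}
  zero_mem' x := by rw [add_zero]
  add_mem' {c d} hc hd x := by
    rw [← add_assoc]
    exact (hc x).trans (hd _)

theorem connected_hammingGraph_of_odd {r : ℕ} (hr : Odd r) (hrn : r < n) :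
    (hammingGraph n r).Connected := by
  have hind : ∀ S : Finset (Fin n), S.card = r →
      (fun k => if k ∈ S then (1 : Bool) else 0) ∈ reachableTranslations n r := by
    intro S hS x
    exact ((hammingGraph_adj_add hr.pos _ _).2 ((binaryWeight_ite_mem S).trans hS)).reachable
  have hpair : ∀ i j : Fin n, Pi.single i (1 : Bool) + Pi.single j 1 ∈
      reachableTranslations n r := by
    intro i j
    rcases eq_or_ne i j with rfl | hij
    · rw [cube_add_self]
      exact zero_mem _
    -- The indicators of T ∪ {i} and T ∪ {j} add up to e_i + e_j. Room for T, of size r-1 among n-2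
    -- points, is where r < n enters.
    obtain ⟨T, hT, hTr⟩ := Finset.exists_subset_card_eq
      (s := (Finset.univ : Finset (Fin n)) \ {i, j}) (n := r - 1) (by
        rw [Finset.card_sdiff_of_subset (Finset.subset_univ _), Finset.card_pair hij,
          Finset.card_univ, Fintype.card_fin]
        omega)
    have hi : i ∉ T := fun h => by simpa using hT h
    have hj : j ∉ T := fun h => by simpa using hT h
    have h1 := hind (insert i T) (by rw [Finset.card_insert_of_notMem hi]; have := hr.pos; omega)
    have h2 := hind (insert j T) (by rw [Finset.card_insert_of_notMem hj]; have := hr.pos; omega)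
    convert add_mem h1 h2 using 1
    funext k
    simp only [Pi.add_apply, Pi.single_apply, Finset.mem_insert]
    by_cases hki : k = i
    · have : k ≠ j := hki ▸ hij
      have : k ∉ T := hki ▸ hi
      simp [*]
    · by_cases hkj : k = j
      · have : k ∉ T := hkj ▸ hj
        simp [*]
      · by_cases hkT : k ∈ T <;> simp [*] <;> rfl
  have hsingle : ∀ i : Fin n, Pi.single i (1 : Bool) ∈ reachableTranslations n r := by
    intro i
    obtain ⟨S, -, hS⟩ := Finset.exists_subset_card_eq (s := (Finset.univ : Finset (Fin n)))
      (n := r) (by simpa using hrn.le)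
    -- This sum is 1_S + r·e_i = 1_S + e_i as r is odd; adding 1_S leaves e_i.
    have h1 : ∑ s ∈ S, (Pi.single s (1 : Bool) + Pi.single i 1) ∈ reachableTranslations n r :=
      sum_mem fun s _ => hpair s i
    rw [Finset.sum_add_distrib, Finset.sum_const, hS] at h1
    have h2 : ∑ s ∈ S, Pi.single s (1 : Bool) = fun k => if k ∈ S then (1 : Bool) else 0 := by
      funext k
      rw [Finset.sum_apply]
      simp [Pi.single_apply]
    obtain ⟨m, rfl⟩ := hr
    rw [h2, succ_nsmul, mul_nsmul, two_nsmul, cube_add_self, nsmul_zero, zero_add] at h1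
    have h3 := add_mem (hind S hS) h1
    rwa [cube_add_cancel_left] at h3
  have hall : ∀ c, c ∈ reachableTranslations n r := by
    intro c
    rw [← Finset.univ_sum_single c]
    refine sum_mem fun i _ => ?_
    cases h : c i
    · change (Pi.single i (0 : Bool) : Fin n → Bool) ∈ _
      rw [Pi.single_zero]
      exact zero_mem _
    · exact hsingle i
  refine ⟨fun x y => ?_⟩
  rw [← cube_add_cancel_left x y]
  exact hall _ x

end BooleanCube

end

theorem mainTheorem10 (n r : ℕ) (hr : 1 ≤ r) (hrn : r ≤ n) :
    (((hammingGraph n r).Connected ∧ HasBalancedRevival (hammingGraph n r) (Real.pi / 8)) ↔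
      ((Odd n ∧ ∀ a b : ℕ, n - 1 ≠ 2 ^ a * (2 ^ b - 1)) ∧ BinaryRewrite (n - 1) (r - 1))) ∧
    (((hammingGraph n r).Connected ∧ HasBalancedRevival (hammingGraph n r) (Real.pi / 8)) ↔
      (Odd n ∧ padicValNat 2 (n - 1) = padicValNat 2 (r - 1) ∧
        (n - 1).choose (r - 1) ≡ 2 [MOD 4])) := by
  have hn : 1 ≤ n := hr.trans hrn
  have hAC : ((hammingGraph n r).Connected ∧
      HasBalancedRevival (hammingGraph n r) (Real.pi / 8)) ↔
      (Odd n ∧ padicValNat 2 (n - 1) = padicValNat 2 (r - 1) ∧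
        (n - 1).choose (r - 1) % 4 = 2) := by
    rw [hasBalancedRevival_hammingGraph_iff hn hr, exists_balanced_iff hn]
    obtain ⟨N, rfl⟩ : ∃ N, n = N + 1 := ⟨n - 1, by omega⟩
    obtain ⟨k, rfl⟩ : ∃ k, r = k + 1 := ⟨r - 1, by omega⟩
    simp only [Nat.add_sub_cancel]
    rw [← odd_and_krawtchouk_congruences_iff]
    refine and_congr_left fun h => ⟨odd_of_connected_hammingGraph hn hr, fun hodd => ?_⟩
    have hc := ((odd_and_krawtchouk_congruences_iff N k).1 ⟨hodd, h⟩).2.2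
    -- If r = n, the binomial coefficient is 1, not 2 modulo 4.
    refine connected_hammingGraph_of_odd hodd (lt_of_le_of_ne hrn fun he => ?_)
    obtain rfl : k = N := by omega
    simp at hc
  refine ⟨?_, hAC⟩
  rw [hAC, ← binaryRewrite_iff]
  exact ⟨fun h => ⟨⟨h.1, h.2.ne_two_pow_mul⟩, h.2⟩, fun h => ⟨h.1.1, h.2⟩⟩
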